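/- Let $\mathit{Act}$ be a finite set of actions with at least two elements, let $\tau\notin\mathit{Act}$ be an unobservable action, and let $\mathit{Var}$ be a countably infinite set of variables. Monitors are the terms generated by the grammar $$m,n ::= v \mid a.m \mid m+n \mid x,\qquad v ::= \mathit{end}\mid \mathit{yes}\mid \mathit{no}\qquad (a\in\mathit{Act},\ x\in\mathit{Var}).$$ For $\alpha\in\mathit{Act}\cup\{\tau\}$ let $\xrightarrow{\alpha}$ be the least relations on monitors such that, for all $a\in\mathit{Act}$, all $\alpha\in\mathit{Act}\cup\{\tau\}$, all monitors $m,n$ and all verdicts $v$: $a.m\xrightarrow{a}m$; $v\xrightarrow{\alpha}v$; and if $m\xrightarrow{\alpha}m'$, then $m+n\xrightarrow{\alpha}m'$ and $n+m\xrightarrow{\alpha}m'$. For a finite string $s=a_1\cdots a_k\in\mathit{Act}^*$, write $m\stackrel{s}{\Rightarrow}m'$ if $m'$ is reachable from $m$ by a sequence of transitions whose labels, after all occurrences of $\tau$ are erased, form $s$. A closed monitor $m$ (one without variables) accepts the set of strings $L_a(m)=\{s\in\mathit{Act}^*\mid m\stackrel{s}{\Rightarrow}\mathit{yes}\}$ and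 rejects the set $L_r(m)=\{s\in\mathit{Act}^*\mid m\stackrel{s}{\Rightarrow}\mathit{no}\}$. Closed monitors $m,n$ are verdict equivalent, $m\simeq n$, if $L_a(m)=L_a(n)$ and $L_r(m)=L_r(n)$; open monitors $m,n$ are verdict equivalent if $\sigma(m)\simeq\sigma(n)$ for every substitution $\sigma$ of closed monitors for the variables. For a set $\mathcal E$ of equations between (open) monitors, write $\mathcal E\vdash m=n$ if $m=n$ is derivable from $\mathcal E$ by the rules of equational logic (reflexivity, symmetry, transitivity, congruence for $a.\_$ and for $+$, and closure under substitutions of arbitrary monitors for variables). Call $\mathcal E$ sound if $\mathcal E\vdash m=n$ implies $m\simeq n$, and complete if $m\simeq n$ implies $\mathcal E\vdash m=n$, for all open monitors $m,n$. Theorem. There is no finite set $\mathcal E$ of equations between monitors that is both sound and complete for verdict equivalence over open monitors. -/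

import Mathlib

namespace RegularMonitor

/-- The three verdicts: `endV` is the inconclusive verdict `end`. -/
inductive Verdict : Type
  | endV
  | yes
  | no

/-- Regular, recursion-free monitors `m ::= v | a.m | m + m | x`. -/
inductive Monitor (Act : Type*) (Var : Type*)
  | verdict (v : Verdict)
  | pre (a : Act) (m : Monitor Act Var)
  | add (m n : Monitor Act Var)
  | var (x : Var)

variable {Act : Type*} {Var : Type*}

/-- A monitor is closed if no variable occurs in it. -/
def Monitor.Closed : Monitor Act Var → Prop
  | .verdict _ => True
  | .pre _ m => m.Closed
  | .add m n => m.Closed ∧ n.Closed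
  | .var _ => False

/-- The monitor `σ(m)` obtained by applying the substitution `σ` to `m`. -/
def Monitor.subst (σ : Var → Monitor Act Var) : Monitor Act Var → Monitor Act Var
  | .verdict v => .verdict v
  | .pre a m => .pre a (m.subst σ)
  | .add m n => .add (m.subst σ) (n.subst σ)
  | .var x => σ x

/-- The transition relations; the label `some a` is the visible action `a`, the label `none` is
the unobservable action `τ`. Variables have no transitions. -/
inductive Step : Option Act → Monitor Act Var → Monitor Act Var → Prop
  | pre (a : Act) (m : Monitor Act Var) : Step (some a) (.pre a m) m
  | addLeft {α : Option Act} {m m' : Monitor Act Var} (n : Monitor Act Var) :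
      Step α m m' → Step α (.add m n) m'
  | addRight {α : Option Act} {n n' : Monitor Act Var} (m : Monitor Act Var) :
      Step α n n' → Step α (.add m n) n'
  | verdict (α : Option Act) (v : Verdict) : Step α (.verdict v) (.verdict v)

/-- `m ⇒ m'` for the empty string: finitely many `τ`-steps. -/
def WeakTau : Monitor Act Var → Monitor Act Var → Prop :=
  Relation.ReflTransGen (Step none)

/-- `m ⇒ m'` for a single visible action `a`. -/
def WeakAct (a : Act) (m m' : Monitor Act Var) : Prop :=
  ∃ m₁ m₂, WeakTau m m₁ ∧ Step (some a) m₁ m₂ ∧ WeakTau m₂ m'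

/-- `m ⇒ m'` for a finite string of visible actions. -/
def Weak : List Act → Monitor Act Var → Monitor Act Var → Prop
  | [], m, m' => WeakTau m m'
  | [a], m, m' => WeakAct a m m'
  | a :: b :: s, m, m' => ∃ m₁, WeakAct a m m₁ ∧ Weak (b :: s) m₁ m'

/-- The acceptance set `L_a(m)`. -/
def acceptSet (m : Monitor Act Var) : Set (List Act) :=
  {s | Weak s m (.verdict .yes)}

/-- The rejection set `L_r(m)`. -/
def rejectSet (m : Monitor Act Var) : Set (List Act) :=
  {s | Weak s m (.verdict .no)}

/-- Verdict equivalence of closed monitors. -/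
def ClosedVerdictEquiv (m n : Monitor Act Var) : Prop :=
  acceptSet m = acceptSet n ∧ rejectSet m = rejectSet n

/-- Verdict equivalence of open monitors: all closed instances are verdict equivalent. (If `m` and
`n` are closed, then `σ(m) = m` and `σ(n) = n`, so this agrees with `ClosedVerdictEquiv`.) -/
def VerdictEquiv (m n : Monitor Act Var) : Prop :=
  ∀ σ : Var → Monitor Act Var, (∀ x, (σ x).Closed) →
    ClosedVerdictEquiv (m.subst σ) (n.subst σ)

/-- `Derivable E m n`: the equation `m = n` is derivable in equational logic from the axiom system
`E`, where the pair `(m, n)` stands for the equation `m = n`. The substitutions are arbitrary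
(open) ones. -/
inductive Derivable (E : Set (Monitor Act Var × Monitor Act Var)) :
    Monitor Act Var → Monitor Act Var → Prop
  | ax {m n : Monitor Act Var} : (m, n) ∈ E → Derivable E m n
  | refl (m : Monitor Act Var) : Derivable E m m
  | symm {m n : Monitor Act Var} : Derivable E m n → Derivable E n m
  | trans {m₁ m₂ m₃ : Monitor Act Var} :
      Derivable E m₁ m₂ → Derivable E m₂ m₃ → Derivable E m₁ m₃
  | congrPre (a : Act) {m n : Monitor Act Var} :
      Derivable E m n → Derivable E (.pre a m) (.pre a n)
  | congrAdd {m₁ n₁ m₂ n₂ : Monitor Act Var} :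
      Derivable E m₁ n₁ → Derivable E m₂ n₂ → Derivable E (.add m₁ m₂) (.add n₁ n₂)
  | subst (σ : Var → Monitor Act Var) {m n : Monitor Act Var} :
      Derivable E m n → Derivable E (m.subst σ) (n.subst σ)

/-- Every equation derivable from `E` is valid for verdict equivalence. -/
def Sound (E : Set (Monitor Act Var × Monitor Act Var)) : Prop :=
  ∀ m n : Monitor Act Var, Derivable E m n → VerdictEquiv m n

/-- Every equation between open monitors that is valid for verdict equivalence is derivable
from `E`. -/
def Complete (E : Set (Monitor Act Var × Monitor Act Var)) : Prop :=
  ∀ m n : Monitor Act Var, VerdictEquiv m n → Derivable E m n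

end RegularMonitor

namespace RegularMonitor

universe u w

variable {Act : Type u} {Var : Type w}

/-! Fix actions a ≠ b, and let T_k reach both `yes` and `no` on all words that are not powers of a,
but accept no a^j with j < k (`exists_reaches_nonpowers`). Then a.x + x + a.T_k = x + a.T_k is
valid: on powers of a the verdicts of x persist under extension, and elsewhere a.T_k already gives
both verdicts.

Sound axioms of depth at most d, where d ≥ 1, cannot prove all these equations. Among terms
accepting no a^i with i ≤ d, their derivations preserve whether x occurs below exactly the prefix a
(`Derivable.hasVar_singleton_iff`). In an axiom such an occurrence is detected by substituting a^d b
(`VerdictEquiv.hasVar_singleton`). For k ≥ d the two sides above are such terms, yet only the left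
one has x in that position. -/

/-- `m.Reaches v s`: the word `s` leads `m` to the verdict `v`, by recursion on the term. -/
def Monitor.Reaches (v : Verdict) : Monitor Act Var → List Act → Prop
  | .verdict v', _ => v' = v
  | .pre a m, s => ∃ s', s = a :: s' ∧ m.Reaches v s'
  | .add m n, s => m.Reaches v s ∨ n.Reaches v s
  | .var _, _ => False

/-- `m.HasVar x s`: the variable `x` occurs in `m` below exactly the prefixes spelling `s`. -/
def Monitor.HasVar (x : Var) : Monitor Act Var → List Act → Prop
  | .verdict _, _ => False
  | .pre a m, s => ∃ s', s = a :: s' ∧ m.HasVar x s'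
  | .add m n, s => m.HasVar x s ∨ n.HasVar x s
  | .var y, s => y = x ∧ s = []

/-- The maximal number of nested prefixes. -/
def Monitor.depth : Monitor Act Var → ℕ
  | .verdict _ => 0
  | .pre _ m => m.depth + 1
  | .add m n => max m.depth n.depth
  | .var _ => 0

open Monitor

/-! ### Structural description of the weak transitions to verdicts. -/

theorem Monitor.Reaches.of_step {v : Verdict} {α : Option Act} {m m' : Monitor Act Var}
    (h : Step α m m') {s : List Act} (hs : m'.Reaches v s) : m.Reaches v (α.toList ++ s) := by
  induction h with
  | pre a m => exact ⟨s, rfl, hs⟩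
  | addLeft n _ ih => exact Or.inl (ih hs)
  | addRight n _ ih => exact Or.inr (ih hs)
  | verdict α v => exact hs

theorem Monitor.Reaches.of_weakTau {v : Verdict} {m m' : Monitor Act Var}
    (h : WeakTau m m') {s : List Act} (hs : m'.Reaches v s) : m.Reaches v s := by
  induction h using Relation.ReflTransGen.head_induction_on with
  | refl => exact hs
  | head h _ ih => exact ih.of_step h

theorem Monitor.Reaches.of_weakAct {v : Verdict} {a : Act} {m m' : Monitor Act Var}
    (h : WeakAct a m m') {s : List Act} (hs : m'.Reaches v s) : m.Reaches v (a :: s) := by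
  obtain ⟨m₁, m₂, h₁, h₂, h₃⟩ := h
  exact ((hs.of_weakTau h₃).of_step h₂).of_weakTau h₁

theorem Monitor.Reaches.weakTau {v : Verdict} {m : Monitor Act Var} (h : m.Reaches v []) :
    WeakTau m (.verdict v) := by
  suffices Step none m (.verdict v) from .single this
  induction m with
  | verdict v' => cases h; exact .verdict _ _
  | pre a m _ => simp [Reaches] at h
  | add m n ihm ihn => exact h.elim (fun h => .addLeft _ (ihm h)) fun h => .addRight _ (ihn h)
  | var x => exact h.elim

theorem Monitor.Reaches.exists_step {v : Verdict} {a : Act} {s : List Act} {m : Monitor Act Var}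
    (h : m.Reaches v (a :: s)) : ∃ m', Step (some a) m m' ∧ m'.Reaches v s := by
  induction m with
  | verdict v' => exact ⟨_, .verdict _ _, h⟩
  | pre b m _ =>
    obtain ⟨s', hs, h⟩ := h
    cases hs
    exact ⟨_, .pre _ _, h⟩
  | add m n ihm ihn =>
    rcases h with h | h
    · obtain ⟨m', h₁, h₂⟩ := ihm h
      exact ⟨m', .addLeft _ h₁, h₂⟩
    · obtain ⟨m', h₁, h₂⟩ := ihn h
      exact ⟨m', .addRight _ h₁, h₂⟩
  | var x => exact h.elim

theorem weak_verdict_iff_reaches {v : Verdict} :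
    ∀ {s : List Act} {m : Monitor Act Var}, Weak s m (.verdict v) ↔ m.Reaches v s
  | [], _ => ⟨fun h => Reaches.of_weakTau h rfl, Reaches.weakTau⟩
  | [a], m => by
    refine ⟨fun h => Reaches.of_weakAct h rfl, fun h => ?_⟩
    obtain ⟨m', h₁, h₂⟩ := h.exists_step
    exact ⟨m, m', .refl, h₁, h₂.weakTau⟩
  | a :: b :: s, m => by
    constructor
    · rintro ⟨m₁, h₁, h₂⟩
      exact (weak_verdict_iff_reaches.1 h₂).of_weakAct h₁
    · intro h
      obtain ⟨m', h₁, h₂⟩ := h.exists_step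
      exact ⟨m', ⟨m, m', .refl, h₁, .refl⟩, weak_verdict_iff_reaches.2 h₂⟩

theorem ClosedVerdictEquiv.reaches_yes_iff {m n : Monitor Act Var} (h : ClosedVerdictEquiv m n)
    (s : List Act) : m.Reaches .yes s ↔ n.Reaches .yes s := by
  rw [← weak_verdict_iff_reaches, ← weak_verdict_iff_reaches]
  exact Set.ext_iff.1 h.1 s

theorem ClosedVerdictEquiv.of_reaches_iff {m n : Monitor Act Var}
    (h : ∀ v, v ≠ .endV → ∀ s, m.Reaches v s ↔ n.Reaches v s) : ClosedVerdictEquiv m n := by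
  constructor <;> ext s
  · exact weak_verdict_iff_reaches.trans ((h .yes (by simp) s).trans weak_verdict_iff_reaches.symm)
  · exact weak_verdict_iff_reaches.trans ((h .no (by simp) s).trans weak_verdict_iff_reaches.symm)

theorem Monitor.Reaches.append {v : Verdict} {m : Monitor Act Var} {s : List Act} (h : m.Reaches v s)
    (t : List Act) : m.Reaches v (s ++ t) := by
  induction m generalizing s with
  | verdict v' => exact h
  | pre a m ih =>
    obtain ⟨s', rfl, h⟩ := h
    exact ⟨s' ++ t, rfl, ih h⟩
  | add m n ihm ihn => exact h.imp (ihm ·) (ihn ·)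
  | var x => exact h

/-- A verdict is reached after consuming at most `depth` prefixes; later letters only loop at it. -/
theorem Monitor.Reaches.take {v : Verdict} {m : Monitor Act Var} {s : List Act} (h : m.Reaches v s)
    {d : ℕ} (hd : m.depth ≤ d) : m.Reaches v (s.take d) := by
  induction m generalizing s d with
  | verdict v' => exact h
  | pre a m ih =>
    obtain ⟨s', rfl, h⟩ := h
    obtain _ | d := d
    · simp [depth] at hd
    · exact ⟨s'.take d, rfl, ih h (Nat.le_of_succ_le_succ hd)⟩
  | add m n ihm ihn =>
    exact h.imp (ihm · (le_of_max_le_left hd)) (ihn · (le_of_max_le_right hd))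
  | var x => exact h

/-! ### Verdicts and variable occurrences under substitution. -/

theorem reaches_subst_iff {v : Verdict} {σ : Var → Monitor Act Var} {m : Monitor Act Var}
    {s : List Act} : (m.subst σ).Reaches v s ↔
      m.Reaches v s ∨ ∃ y t r, s = t ++ r ∧ m.HasVar y t ∧ (σ y).Reaches v r := by
  induction m generalizing s with
  | verdict v' => simp [subst, Reaches, HasVar]
  | pre a m ih =>
    simp only [subst, Reaches, HasVar, ih]
    constructor
    · rintro ⟨s', rfl, h | ⟨y, t, r, rfl, h₁, h₂⟩⟩
      · exact .inl ⟨s', rfl, h⟩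
      · exact .inr ⟨y, a :: t, r, rfl, ⟨t, rfl, h₁⟩, h₂⟩
    · rintro (⟨s', rfl, h⟩ | ⟨y, _, r, rfl, ⟨t, rfl, h₁⟩, h₂⟩)
      · exact ⟨s', rfl, .inl h⟩
      · exact ⟨t ++ r, rfl, .inr ⟨y, t, r, rfl, h₁, h₂⟩⟩
  | add m n ihm ihn =>
    simp only [subst, Reaches, HasVar, ihm, ihn]
    grind
  | var x => simp [subst, Reaches, HasVar]

theorem hasVar_subst_iff {x : Var} {σ : Var → Monitor Act Var} {m : Monitor Act Var}
    {s : List Act} : (m.subst σ).HasVar x s ↔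
      ∃ y t r, s = t ++ r ∧ m.HasVar y t ∧ (σ y).HasVar x r := by
  induction m generalizing s with
  | verdict v' => simp [subst, HasVar]
  | pre a m ih =>
    simp only [subst, HasVar, ih]
    constructor
    · rintro ⟨s', rfl, y, t, r, rfl, h₁, h₂⟩
      exact ⟨y, a :: t, r, rfl, ⟨t, rfl, h₁⟩, h₂⟩
    · rintro ⟨y, _, r, rfl, ⟨t, rfl, h₁⟩, h₂⟩
      exact ⟨t ++ r, rfl, y, t, r, rfl, h₁, h₂⟩
  | add m n ihm ihn =>
    simp only [subst, HasVar, ihm, ihn]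
    grind
  | var x => simp [subst, HasVar]

theorem subst_subst (σ ρ : Var → Monitor Act Var) (m : Monitor Act Var) :
    (m.subst σ).subst ρ = m.subst fun y => (σ y).subst ρ := by
  induction m <;> simp_all [subst]

theorem subst_var (m : Monitor Act Var) : m.subst .var = m := by
  induction m <;> simp_all [subst]

/-- The monitor accepting exactly the words that extend `t`. -/
def wordYes : List Act → Monitor Act Var
  | [] => .verdict .yes
  | a :: t => .pre a (wordYes t)

theorem closed_wordYes (t : List Act) : (wordYes t : Monitor Act Var).Closed := by
  induction t with
  | nil => trivial
  | cons a t ih => exact ih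

theorem reaches_wordYes_iff {t s : List Act} :
    (wordYes t : Monitor Act Var).Reaches .yes s ↔ t <+: s := by
  induction t generalizing s with
  | nil => simp [wordYes, Reaches]
  | cons a t ih => simp [wordYes, Reaches, ih, List.cons_prefix_iff]

/-! ### Detecting variable occurrences by closed substitutions. -/

theorem VerdictEquiv.symm {m n : Monitor Act Var} (h : VerdictEquiv m n) : VerdictEquiv n m :=
  fun σ hσ => ⟨(h σ hσ).1.symm, (h σ hσ).2.symm⟩

theorem VerdictEquiv.reaches_yes_iff {m n : Monitor Act Var} (h : VerdictEquiv m n) (s : List Act) :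
    m.Reaches .yes s ↔ n.Reaches .yes s := by
  simpa [reaches_subst_iff, Reaches] using
    (h (fun _ => .verdict .endV) fun _ => trivial).reaches_yes_iff s

/-- Observing an occurrence of `y` through the substitution mapping `y` to `wordYes w`, and all
other variables to `end`. -/
theorem VerdictEquiv.reaches_or_hasVar {m n : Monitor Act Var} (h : VerdictEquiv m n) {y : Var}
    {t : List Act} (hy : m.HasVar y t) (w : List Act) :
    n.Reaches .yes (t ++ w) ∨ ∃ t' r, t ++ w = t' ++ (w ++ r) ∧ n.HasVar y t' := by
  classical
  let σ : Var → Monitor Act Var := fun z => if z = y then wordYes w else .verdict .endV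
  have hσ : ∀ z, (σ z).Closed := by
    intro z
    by_cases hz : z = y
    · simpa [σ, hz] using closed_wordYes w
    · simp [σ, hz, Closed]
  have hm : (m.subst σ).Reaches .yes (t ++ w) :=
    reaches_subst_iff.2 (.inr ⟨y, t, w, rfl, hy, by simp [σ, reaches_wordYes_iff]⟩)
  rw [(h σ hσ).reaches_yes_iff, reaches_subst_iff] at hm
  refine hm.imp_right ?_
  rintro ⟨z, t', r, hr, hz, hacc⟩
  by_cases hzy : z = y
  · subst hzy
    obtain ⟨r', rfl⟩ : w <+: r := by simpa [σ, reaches_wordYes_iff] using hacc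
    exact ⟨t', r', hr, hz⟩
  · simp [σ, hzy, Reaches] at hacc

/-- Substituting `yes` for y makes a bare summand y accept the empty word. -/
theorem VerdictEquiv.hasVar_nil {m n : Monitor Act Var} (h : VerdictEquiv m n) {y : Var}
    (hy : m.HasVar y []) (hn : ¬ n.Reaches .yes []) : n.HasVar y [] := by
  obtain h | ⟨t', r, ht, h⟩ := h.reaches_or_hasVar hy []
  · exact (hn h).elim
  · obtain ⟨rfl, -⟩ : t' = [] ∧ r = [] := by simpa using ht
    exact h

/-- For terms of depth at most `d` that accept no power `aⁱ` with `i ≤ d`, occurrences of a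
variable below the single prefix `a` are determined by the verdict equivalence class. -/
theorem VerdictEquiv.hasVar_singleton {m n : Monitor Act Var} (h : VerdictEquiv m n) {y : Var}
    {a b : Act} (hab : a ≠ b) {d : ℕ} (hd : n.depth ≤ d)
    (hn : ∀ i ≤ d, ¬ n.Reaches .yes (List.replicate i a))
    (hy : m.HasVar y [a]) : n.HasVar y [a] := by
  -- The test word is a^(d+1) b. Its first d letters are powers of a, which rules out acceptance by
  -- `n` itself; the final b marks the position of the substituted word and excludes a bare y.
  obtain h | ⟨t', r, ht, h⟩ := h.reaches_or_hasVar hy (List.replicate d a ++ [b])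
  · have h' := h.take hd
    rw [← List.append_assoc, List.take_append_of_le_length (by simp),
      show [a] ++ List.replicate d a = List.replicate (d + 1) a from rfl,
      List.take_replicate] at h'
    exact (hn _ (by simp) h').elim
  · have hlen := congrArg List.length ht
    rcases t' with _ | ⟨c, _ | ⟨c', t'⟩⟩
    · have h' := congrArg (fun l => l[d]?) ht
      rw [← List.append_assoc, show [a] ++ List.replicate d a = List.replicate (d + 1) a from rfl]
        at h'
      exact (hab (by simpa using h')).elim
    · obtain ⟨rfl, -⟩ : a = c ∧ _ := by simpa using ht
      exact h
    · simp at hlen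
      omega

/-! ### The invariant of derivations. -/

/-- A sound derivation from equations of depth at most `d` preserves occurrences of `x` below the
single prefix `a` in terms that accept no power `aⁱ` with `i ≤ d`. -/
theorem Derivable.hasVar_singleton_iff {E : Set (Monitor Act Var × Monitor Act Var)}
    (hE : Sound E) {d : ℕ} (hd₁ : 1 ≤ d) (hd : ∀ p ∈ E, p.1.depth ≤ d ∧ p.2.depth ≤ d)
    {a b : Act} (hab : a ≠ b) {x : Var} {m n : Monitor Act Var} (h : Derivable E m n)
    (σ : Var → Monitor Act Var)
    (hm : ∀ i ≤ d, ¬ (m.subst σ).Reaches .yes (List.replicate i a)) :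
    (m.subst σ).HasVar x [a] ↔ (n.subst σ).HasVar x [a] := by
  -- An occurrence of x in an axiom instance comes from some variable y of the axiom, itself bare or
  -- below a; both positions transfer to the other side. The depth bound concerns the axiom only,
  -- not `σ`.
  have key {m n : Monitor Act Var} (hmn : VerdictEquiv m n) (hdn : n.depth ≤ d)
      (σ : Var → Monitor Act Var)
      (hn : ∀ i ≤ d, ¬ (n.subst σ).Reaches .yes (List.replicate i a))
      (hx : (m.subst σ).HasVar x [a]) : (n.subst σ).HasVar x [a] := by
    have hn' : ∀ i ≤ d, ¬ n.Reaches .yes (List.replicate i a) :=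
      fun i hi h => hn i hi (reaches_subst_iff.2 (.inl h))
    obtain ⟨y, t, r, htr, hy, hx⟩ := hasVar_subst_iff.1 hx
    refine hasVar_subst_iff.2 ⟨y, t, r, htr, ?_, hx⟩
    obtain ⟨rfl, -⟩ | ⟨rfl, -⟩ : t = [] ∧ r = [a] ∨ t = [a] ∧ r = [] := by
      simpa [eq_comm, List.append_eq_singleton_iff] using htr.symm
    · exact hmn.hasVar_nil hy (hn' 0 (Nat.zero_le _))
    · exact hmn.hasVar_singleton hab hdn hn' hy
  have equiv {m n : Monitor Act Var} (h : Derivable E m n) (σ : Var → Monitor Act Var) :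
      VerdictEquiv (m.subst σ) (n.subst σ) := hE _ _ (h.subst σ)
  induction h generalizing σ with
  | ax h =>
    refine ⟨key (hE _ _ (.ax h)) (hd _ h).2 σ fun i hi hi' => hm i hi ?_,
      key (hE _ _ (.ax h)).symm (hd _ h).1 σ hm⟩
    exact ((equiv (.ax h) σ).reaches_yes_iff _).2 hi'
  | refl m => rfl
  | symm h ih => exact (ih σ fun i hi hi' => hm i hi (((equiv h σ).reaches_yes_iff _).1 hi')).symm
  | trans h₁ _ ih₁ ih₂ =>
    exact (ih₁ σ hm).trans
      (ih₂ σ fun i hi hi' => hm i hi (((equiv h₁ σ).reaches_yes_iff _).2 hi'))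
  | congrPre c h _ =>
    -- Below the prefix x must be bare, so soundness of the premise suffices; the induction
    -- hypothesis speaks about the wrong position.
    have hv := equiv h σ
    have aux : ∀ {p : Monitor Act Var}, (Monitor.pre c p).HasVar x [a] ↔ a = c ∧ p.HasVar x [] := by
      simp [HasVar, and_assoc]
    simp only [Monitor.subst] at hm ⊢
    rw [aux, aux]
    refine and_congr_right ?_
    rintro rfl
    have h0 := fun h0 => hm 1 hd₁ ⟨[], rfl, h0⟩
    exact ⟨fun hx => hv.hasVar_nil hx fun h => h0 ((hv.reaches_yes_iff _).2 h),
      fun hx => hv.symm.hasVar_nil hx h0⟩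
  | congrAdd _ _ ih₁ ih₂ =>
    exact or_congr (ih₁ σ fun i hi h => hm i hi (.inl h)) (ih₂ σ fun i hi h => hm i hi (.inr h))
  | subst ρ h ih =>
    -- Since `σ` is universally quantified in the induction, `ρ` is absorbed into it.
    simp only [subst_subst] at hm ⊢
    exact ih _ hm

/-! ### The family of valid equations that defeats every finite axiom system. -/

/-- The monitor `yes + no`. -/
def both : Monitor Act Var := .add (.verdict .yes) (.verdict .no)

theorem reaches_both {v : Verdict} (hv : v ≠ .endV) (s : List Act) :
    (both : Monitor Act Var).Reaches v s := by
  cases v <;> simp_all [both, Reaches]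

/-- Used with all actions other than a, which is where finiteness of `Act` enters. -/
theorem exists_sum_pre_both (l : List Act) :
    ∃ N : Monitor Act Var, ∀ v, v ≠ .endV → ∀ (σ : Var → Monitor Act Var) (s : List Act),
      (N.subst σ).Reaches v s ↔ ∃ b ∈ l, ∃ s', s = b :: s' := by
  induction l with
  | nil =>
    refine ⟨.verdict .endV, fun v hv σ s => ?_⟩
    simpa [subst, Reaches] using hv.symm
  | cons b l ih =>
    obtain ⟨N, hN⟩ := ih
    refine ⟨.add (.pre b both) N, fun v hv σ s => ?_⟩
    have := reaches_both (Var := Var) (Act := Act) hv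
    simp only [subst, both, Reaches] at this ⊢
    simp [hN v hv, this []]

/-- There is a monitor reaching both `yes` and `no` on every word that is not a power of `a`, and
neither on `aʲ` for `j < k`. -/
theorem exists_reaches_nonpowers [Finite Act] (a : Act) (k : ℕ) :
    ∃ T : Monitor Act Var, (∀ v, v ≠ .endV → ∀ (σ : Var → Monitor Act Var) (s : List Act),
        (T.subst σ).Reaches v s ∨ ∃ j, s = List.replicate j a) ∧
      ∀ (σ : Var → Monitor Act Var), ∀ j < k, ¬ (T.subst σ).Reaches .yes (List.replicate j a) := by
  classical
  have := Fintype.ofFinite Act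
  obtain ⟨N, hN⟩ := exists_sum_pre_both (Var := Var) (Finset.univ.erase a).toList
  induction k with
  | zero => exact ⟨both, fun v hv σ s => .inl (reaches_both hv s), by simp⟩
  | succ k ih =>
    obtain ⟨T, hT₁, hT₂⟩ := ih
    -- T_(k+1) = a.T_k + Σ_{c ≠ a} c.(yes + no).
    refine ⟨.add (.pre a T) N, fun v hv σ s => ?_, fun σ j hj => ?_⟩
    · rcases s with _ | ⟨b, s⟩
      · exact .inr ⟨0, rfl⟩
      · by_cases hb : b = a
        · subst hb
          rcases hT₁ v hv σ s with h | ⟨j, rfl⟩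
          · exact .inl (.inl ⟨s, rfl, h⟩)
          · exact .inr ⟨j + 1, rfl⟩
        · exact .inl (.inr ((hN v hv σ _).2 ⟨b, by simp [hb], s, rfl⟩))
    · rintro (⟨s', hs, h⟩ | h)
      · obtain _ | j := j
        · simp at hs
        · cases hs
          exact hT₂ σ j (by omega) h
      · obtain ⟨b, hb, s', hs⟩ := (hN .yes (by simp) σ _).1 h
        obtain _ | j := j
        · simp at hs
        · cases hs
          simp at hb

theorem not_finite_sound_complete [Finite Act] [Nontrivial Act] (x : Var)
    {E : Set (Monitor Act Var × Monitor Act Var)} (hfin : E.Finite) (hE : Sound E) :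
    ¬ Complete E := by
  intro hC
  obtain ⟨a, b, hab⟩ := exists_pair_ne Act
  obtain ⟨d₀, hd₀⟩ := (hfin.image fun p => max p.1.depth p.2.depth).bddAbove
  obtain ⟨T, hT₁, hT₂⟩ := exists_reaches_nonpowers (Var := Var) a (d₀ + 1)
  let n : Monitor Act Var := .add (.var x) (.pre a T)
  have hvalid : VerdictEquiv (.add (.pre a (.var x)) n) n := by
    intro σ _
    refine .of_reaches_iff fun v hv s => ⟨?_, .inr⟩
    rintro (⟨s', rfl, h⟩ | h)
    · rcases hT₁ v hv σ s' with h' | ⟨j, rfl⟩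
      · exact .inr ⟨s', rfl, h'⟩
      · refine .inl ?_
        -- As a·a^j = a^j·a, the word extends one on which x already reaches `v`.
        rw [← List.replicate_succ, List.replicate_succ']
        exact Reaches.append h [a]
    · exact h
  have hder := (hC _ _ hvalid).symm
  -- The successor ensures d ≥ 1 even if all axioms have depth 0.
  have hx := hder.hasVar_singleton_iff (d := d₀ + 1) (x := x) hE (by omega)
    (fun p hp => max_le_iff.1 ((hd₀ ⟨p, hp, rfl⟩).trans (Nat.le_succ d₀))) hab .var ?_
  · obtain h | ⟨s', hs, h⟩ := hx.2 (.inl ⟨[], rfl, rfl, rfl⟩)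
    · simp [subst, HasVar] at h
    · obtain rfl : [] = s' := by simpa using hs
      -- A bare x in `T` would make `T` accept the empty word once x is replaced by `yes`.
      exact hT₂ (fun _ => .verdict .yes) 0 (by omega)
        (reaches_subst_iff.2 (.inr ⟨x, [], [], rfl, by rwa [subst_var] at h, rfl⟩))
  · rintro i hi (h | ⟨s', hs, h⟩)
    · exact h
    · obtain _ | i := i
      · simp at hs
      · cases hs
        exact hT₂ _ i (by omega) h

end RegularMonitor

theorem mainTheorem6 {Act : Type*} [Finite Act] [Nontrivial Act]
    {Var : Type*} [Countable Var] [Infinite Var] :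
    ¬ ∃ E : Set (RegularMonitor.Monitor Act Var × RegularMonitor.Monitor Act Var),
      E.Finite ∧ RegularMonitor.Sound E ∧ RegularMonitor.Complete E := by
  rintro ⟨E, hfin, hE, hC⟩
  obtain ⟨x⟩ := (inferInstance : Nonempty Var)
  exact RegularMonitor.not_finite_sound_complete x hfin hE hC
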